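/- All graphs are finite, simple and connected, and $d$ is the path distance. For a graph $G$: * For $k,\ell\ge 0$ let $MC_k^\ell(G)$ be the free abelian group on the tuples $(x_0,\dots,x_k)\in V(G)^{k+1}$ with $x_i\ne x_{i+1}$ for all $i$ and $\sum_i d(x_i,x_{i+1})=\ell$. The boundary is $\partial=\sum_{i=1}^{k-1}(-1)^i\partial_i$, where $\partial_i$ omits $x_i$ if this preserves the length, and is $0$ otherwise. The magnitude homology is $MH_k^\ell(G)=H_k(MC_*^\ell(G))$, and $G$ is *diagonal* if $MH_k^\ell(G)=0$ whenever $k\ne\ell$. * The magnitude of $G$ is $\#G=\sum_{x,y}Z_G^{-1}(x,y)\in\mathbb Q(q)$, where $Z_G=(q^{d(x,y)})_{x,y\in V(G)}$. * $G$ is *pawful* if all distances are at most $2$ and for all $x,y,z$ with $d(x,y)=d(y,z)=2$ and $d(x,z)=1$ there is a vertex $a$ with $d(a,x)=d(a,y)=d(a,z)=1$. * Let all distances in $G$ be at most $2$, and put $X=\{(a,b,c): d(a,b)=d(b,c)=1,\ d(a,c)=2\}$, $Y=\{(\alpha,\beta,\gamma,\delta): d(\alpha,\beta)=d(\beta,\gamma)=d(\gamma,\delta)=1,\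 d(\beta,\delta)=2\}$, $X'=\{(a,c): d(a,c)=2\}$, $Y'=\{(\alpha,\beta,\delta): d(\alpha,\beta)=1,\ d(\beta,\delta)=2\}$, with the projections $\pi:X\to X'$, $(a,b,c)\mapsto(a,c)$, and $\pi:Y\to Y'$, $(\alpha,\beta,\gamma,\delta)\mapsto(\alpha,\beta,\delta)$. Call $\mathcal S\subseteq X\sqcup Y$ *admissible* if $\mathcal S=f_1(X')\sqcup f_2(Y')$ for maps $f_1:X'\to X$ and $f_2:Y'\to Y$ such that (i) $\pi\circ f_1=\mathrm{id}$ and $\pi\circ f_2=\mathrm{id}$; (ii) if $(\alpha,\beta,\gamma,\delta)\in f_2(Y')$, then $(\varepsilon,\alpha,\beta,\gamma)\notin f_2(Y')$ for every vertex $\varepsilon$, and $(\alpha,\beta,\gamma)\notin f_1(X')$; (iii) if $(\alpha,\beta,\gamma,\delta)\in f_2(Y')$ and $d(\alpha,\gamma)=2$, then there is no $\gamma'\ne\gamma$ with $d(\beta,\gamma')=d(\gamma',\delta)=1$. Let $G_1$ be the graph with vertices $1,\dots,6$ and edges $12,23,34,45,51,25,26,36,46,56$. Then: 1. $G_1$ is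 connected, has diameter $2$, and is not pawful. 2. $G_1$ has an admissible set $\mathcal S=f_1(X')\sqcup f_2(Y')$, namely with $$f_1(X')=\{(1,2,3),(1,5,4),(1,2,6),(2,6,4),(3,2,1),(3,6,5),(4,5,1),(4,6,2),(5,6,3),(6,2,1)\}$$ and $f_2(Y')$ consisting of $(2,1,2,3)$, $(5,1,2,3)$, $(2,1,5,4)$, $(5,1,5,4)$, $(2,1,2,6)$, $(5,1,2,6)$, $(1,2,5,4)$, $(3,2,6,4)$, $(5,2,6,4)$, $(6,2,6,4)$, $(2,3,2,1)$, $(4,3,2,1)$, $(6,3,2,1)$, $(2,3,6,5)$, $(4,3,6,5)$, $(6,3,6,5)$, $(3,4,5,1)$, $(5,4,5,1)$, $(6,4,5,1)$, $(3,4,6,2)$, $(5,4,6,2)$, $(6,4,6,2)$, $(1,5,2,3)$, $(2,5,6,3)$, $(4,5,6,3)$, $(6,5,6,3)$, $(2,6,2,1)$, $(3,6,2,1)$, $(4,6,5,1)$, $(5,6,5,1)$. 3. $G_1$ is diagonal. 4. $Z_{G_1}$ is invertible over $\mathbb Q(q)$ and $$\#G_1=\frac{2q^3+4q^2-10q-6}{q^5+q^4-6q^2-5q-1}=6-20q+60q^2-182q^3+556q^4-1702q^5+5214q^6-15980q^7+\cdots.$$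 5. The expansion of $\#G_1$ at $q=0$ is $\#G_1=\sum_{\ell\ge0}(-1)^\ell r_\ell q^\ell$ with integers $r_\ell\ge 0$, and $MH_\ell^\ell(G_1)\cong\mathbb Z^{r_\ell}$ for every $\ell\ge 0$; thus $MH_0^0(G_1)\cong\mathbb Z^6$, $MH_1^1(G_1)\cong\mathbb Z^{20}$, $MH_2^2(G_1)\cong\mathbb Z^{60}$, and so on. All other $MH_k^\ell(G_1)$ vanish. -/

import Mathlib

namespace MagnitudeHomology

section General

variable {V : Type*}

/-- The length `L(x) = d(x₀, x₁) + ⋯ + d(x_{k-1}, x_k)` of a tuple of vertices. -/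
noncomputable def len (G : SimpleGraph V) {k : ℕ} (x : Fin (k + 1) → V) : ℕ :=
  ∑ i : Fin k, G.dist (x i.castSucc) (x i.succ)

/-- A tuple of vertices is a sequence if consecutive entries are different. -/
def IsSeq {k : ℕ} (x : Fin (k + 1) → V) : Prop :=
  ∀ i : Fin k, x i.castSucc ≠ x i.succ

/-- The sequences `(x₀, …, x_k)` of length `ℓ`, the standard basis of `MC_k^ℓ(G)`. -/
abbrev Seq (G : SimpleGraph V) (k ℓ : ℕ) : Type _ :=
  {x : Fin (k + 1) → V // IsSeq x ∧ len G x = ℓ}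

/-- The magnitude chain group `MC_k^ℓ(G)`: the free abelian group on the sequences
`(x₀, …, x_k)` of length `ℓ`. -/
abbrev MC (G : SimpleGraph V) (k ℓ : ℕ) : Type _ := Seq G k ℓ →₀ ℤ

open Classical in
/-- The map `∂_i` on a basis element: omit `x_i` if this leaves the length unchanged
(i.e. `x_i` is smooth), and `0` otherwise. In a connected graph a tuple obtained from a sequence
by omitting a smooth point is again a sequence (see `len_omit_le_and` below), so that
the condition `IsSeq` here is automatic. -/
noncomputable def faceBasis (G : SimpleGraph V) (k ℓ : ℕ) (i : Fin (k + 2))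
    (x : Seq G (k + 1) ℓ) : MC G k ℓ :=
  if h : IsSeq (fun j => x.1 (i.succAbove j)) ∧ len G (fun j => x.1 (i.succAbove j)) = ℓ then
    Finsupp.single ⟨fun j => x.1 (i.succAbove j), h⟩ 1
  else 0

/-- The map `∂_i : MC_{k+1}^ℓ(G) → MC_k^ℓ(G)`. -/
noncomputable def face (G : SimpleGraph V) (k ℓ : ℕ) (i : Fin (k + 2)) :
    MC G (k + 1) ℓ →ₗ[ℤ] MC G k ℓ :=
  Finsupp.linearCombination ℤ (faceBasis G k ℓ i)

/-- The boundary map `∂ = ∑_{0 < i < k+1} (-1)^i ∂_i : MC_{k+1}^ℓ(G) → MC_k^ℓ(G)`;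
only interior points are omitted. -/
noncomputable def boundary (G : SimpleGraph V) (k ℓ : ℕ) :
    MC G (k + 1) ℓ →ₗ[ℤ] MC G k ℓ :=
  ∑ i : Fin (k + 2) with i ≠ 0 ∧ i ≠ Fin.last (k + 1), (-1 : ℤ) ^ (i : ℕ) • face G k ℓ i

/-- The cycles in `MC_k^ℓ(G)`; in degree `0` everything is a cycle. -/
noncomputable def cycles (G : SimpleGraph V) : (k ℓ : ℕ) → Submodule ℤ (MC G k ℓ)
  | 0, _ => ⊤
  | k + 1, ℓ => LinearMap.ker (boundary G k ℓ)

/-- The magnitude homology `MH_k^ℓ(G)`: cycles modulo boundaries. For a connected graph the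
boundaries are cycles (see `boundary_comp_boundary` below). -/
abbrev MH (G : SimpleGraph V) (k ℓ : ℕ) : Type _ :=
  cycles G k ℓ ⧸ (LinearMap.range (boundary G k ℓ)).submoduleOf (cycles G k ℓ)

/-- A graph is diagonal if `MH_k^ℓ(G) = 0` for `k ≠ ℓ`. -/
def IsDiagonal (G : SimpleGraph V) : Prop :=
  ∀ k ℓ : ℕ, k ≠ ℓ → Subsingleton (MH G k ℓ)

/-- Pawful graphs. -/
def IsPawful (G : SimpleGraph V) : Prop :=
  G.Connected ∧ (∀ x y : V, G.dist x y ≤ 2) ∧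
    ∀ x y z : V, G.dist x y = 2 → G.dist y z = 2 → G.dist x z = 1 →
      ∃ a : V, G.dist a x = 1 ∧ G.dist a y = 1 ∧ G.dist a z = 1

/-- `Z_G = (q^{d(x,y)})_{x,y}` over `ℚ(q)`. -/
noncomputable def zMatrix (G : SimpleGraph V) : Matrix V V (RatFunc ℚ) :=
  Matrix.of fun x y => RatFunc.X ^ G.dist x y

/-- The magnitude `#G ∈ ℚ(q)`, the sum of the entries of `Z_G⁻¹`. -/
noncomputable def magnitude [Fintype V] [DecidableEq V] (G : SimpleGraph V) : RatFunc ℚ :=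
  ∑ x : V, ∑ y : V, (zMatrix G)⁻¹ x y

/-- `X = {(a, b, c) | d(a,b) = d(b,c) = 1, d(a,c) = 2}`. -/
def setX (G : SimpleGraph V) : Set (V × V × V) :=
  {p | G.dist p.1 p.2.1 = 1 ∧ G.dist p.2.1 p.2.2 = 1 ∧ G.dist p.1 p.2.2 = 2}

/-- `Y = {(α, β, γ, δ) | d(α,β) = d(β,γ) = d(γ,δ) = 1, d(β,δ) = 2}`. -/
def setY (G : SimpleGraph V) : Set (V × V × V × V) :=
  {p | G.dist p.1 p.2.1 = 1 ∧ G.dist p.2.1 p.2.2.1 = 1 ∧ G.dist p.2.2.1 p.2.2.2 = 1 ∧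
    G.dist p.2.1 p.2.2.2 = 2}

/-- `X' = {(a, c) | d(a,c) = 2}`. -/
def setX' (G : SimpleGraph V) : Set (V × V) :=
  {p | G.dist p.1 p.2 = 2}

/-- `Y' = {(α, β, δ) | d(α,β) = 1, d(β,δ) = 2}`. -/
def setY' (G : SimpleGraph V) : Set (V × V × V) :=
  {p | G.dist p.1 p.2.1 = 1 ∧ G.dist p.2.1 p.2.2 = 2}

/-- The projection `π : X → X'`, `(a, b, c) ↦ (a, c)`. -/
def projX (G : SimpleGraph V) (p : setX G) : setX' G :=
  ⟨(p.1.1, p.1.2.2), p.2.2.2⟩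

/-- The projection `π : Y → Y'`, `(α, β, γ, δ) ↦ (α, β, δ)`. -/
def projY (G : SimpleGraph V) (p : setY G) : setY' G :=
  ⟨(p.1.1, p.1.2.1, p.1.2.2.2), p.2.1, p.2.2.2.2⟩

/-- Conditions (i), (ii), (iii) on a pair of maps `f₁ : X' → X` and `f₂ : Y' → Y`. -/
structure IsAdmissiblePair (G : SimpleGraph V) (f₁ : setX' G → setX G)
    (f₂ : setY' G → setY G) : Prop where
  proj₁ : projX G ∘ f₁ = id
  proj₂ : projY G ∘ f₂ = id
  /-- if `(α, β, γ, δ) ∈ f₂(Y')` then `(*, α, β, γ) ∉ f₂(Y')` -/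
  not_mem₂ : ∀ α β γ δ : V, (α, β, γ, δ) ∈ Subtype.val '' Set.range f₂ →
    ∀ ε : V, (ε, α, β, γ) ∉ Subtype.val '' Set.range f₂
  /-- if `(α, β, γ, δ) ∈ f₂(Y')` then `(α, β, γ) ∉ f₁(X')` -/
  not_mem₁ : ∀ α β γ δ : V, (α, β, γ, δ) ∈ Subtype.val '' Set.range f₂ →
    (α, β, γ) ∉ Subtype.val '' Set.range f₁
  /-- if `(α, β, γ, δ) ∈ f₂(Y')` and `d(α,γ) = 2` then `γ` is the only common neighbour of
  `β` and `δ` -/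
  unique : ∀ α β γ δ : V, (α, β, γ, δ) ∈ Subtype.val '' Set.range f₂ → G.dist α γ = 2 →
    ¬ ∃ γ' : V, γ' ≠ γ ∧ G.dist β γ' = 1 ∧ G.dist γ' δ = 1

/-- `S ⊆ X ⊔ Y` is admissible for a graph `G` with all distances at most `2` if it is
`f₁(X') ⊔ f₂(Y')` for maps `f₁`, `f₂` that satisfy (i), (ii), (iii). -/
def IsAdmissibleSet (G : SimpleGraph V) (S : Set (setX G ⊕ setY G)) : Prop :=
  G.Connected ∧ (∀ x y : V, G.dist x y ≤ 2) ∧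
    ∃ (f₁ : setX' G → setX G) (f₂ : setY' G → setY G), IsAdmissiblePair G f₁ f₂ ∧
      S = Sum.inl '' Set.range f₁ ∪ Sum.inr '' Set.range f₂

/-! ### Well-definedness of the complex -/

theorem len_succ (G : SimpleGraph V) {k : ℕ} (x : Fin (k + 2) → V) :
    len G x = G.dist (x 0) (x 1) + len G (fun j => x j.succ) := by
  simp only [len]
  rw [Fin.sum_univ_succ]
  rfl

theorem isSeq_succ {k : ℕ} (x : Fin (k + 2) → V) :
    IsSeq x ↔ x 0 ≠ x 1 ∧ IsSeq (fun j => x j.succ) := by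
  simp only [IsSeq]
  rw [Fin.forall_fin_succ]
  rfl

/-- Omitting a point does not increase the length, and if it preserves the length of a sequence
then the result is a sequence. -/
theorem len_omit_le_and {G : SimpleGraph V} (hG : G.Connected) {k : ℕ} (x : Fin (k + 2) → V)
    (i : Fin (k + 2)) :
    len G (fun j => x (i.succAbove j)) ≤ len G x ∧
      (IsSeq x → len G (fun j => x (i.succAbove j)) = len G x →
        IsSeq (fun j => x (i.succAbove j))) := by
  induction k with
  | zero => exact ⟨by simp [len], fun _ _ j => j.elim0⟩
  | succ k ih =>
    rcases Fin.eq_zero_or_eq_succ i with rfl | ⟨i, rfl⟩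
    · simp only [Fin.succAbove_zero]
      rw [len_succ G x, isSeq_succ x]
      exact ⟨by omega, fun h _ => h.2⟩
    · obtain ⟨h1, h2⟩ := ih (fun j => x j.succ) i
      rw [len_succ G x, len_succ G (fun j => x (i.succ.succAbove j)), isSeq_succ x,
        isSeq_succ (fun j => x (i.succ.succAbove j))]
      simp only [Fin.succ_succAbove_succ, Fin.succ_succAbove_zero]
      rw [show (1 : Fin (k + 2)) = Fin.succ 0 from rfl, Fin.succ_succAbove_succ]
      rcases Fin.eq_zero_or_eq_succ i with rfl | ⟨i, rfl⟩
      · simp only [Fin.succAbove_zero] at h1 h2 ⊢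
        rw [len_succ G (fun j => x j.succ)] at *
        have ht := hG.dist_triangle (u := x 0) (v := x 1) (w := x (Fin.succ (Fin.succ 0)))
        have e : x (Fin.succ (1 : Fin (k + 2))) = x (Fin.succ (Fin.succ 0)) := rfl
        have e' : x (Fin.succ (0 : Fin (k + 2))) = x 1 := rfl
        simp only [e, e'] at *
        refine ⟨by omega, fun hs hl => ⟨fun h0 => ?_, (isSeq_succ _).1 hs.2 |>.2⟩⟩
        have := hG.pos_dist_of_ne hs.1
        rw [← h0, SimpleGraph.dist_self] at hl
        omega
      · have e : (i.succ.succAbove (0 : Fin (k + 1))).succ = (1 : Fin (k + 3)) := by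
          rw [Fin.succ_succAbove_zero]
          rfl
        rw [e]
        exact ⟨Nat.add_le_add_left h1 _, fun hs hl => ⟨hs.1, h2 hs.2 (Nat.add_left_cancel hl)⟩⟩

theorem len_castSucc (G : SimpleGraph V) {k : ℕ} (x : Fin (k + 2) → V) :
    len G x = len G (fun j => x j.castSucc) +
      G.dist (x (Fin.last k).castSucc) (x (Fin.last (k + 1))) := by
  simp only [len]
  rw [Fin.sum_univ_castSucc]
  rfl

theorem face_end {G : SimpleGraph V} (hG : G.Connected) (k ℓ : ℕ) (i : Fin (k + 2))
    (hi : i = 0 ∨ i = Fin.last (k + 1)) : face G k ℓ i = 0 := by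
  refine Finsupp.lhom_ext' fun x => LinearMap.ext_ring ?_
  simp only [face, LinearMap.comp_apply, Finsupp.lsingle_apply,
    Finsupp.linearCombination_single, one_smul, LinearMap.zero_apply]
  refine dif_neg fun h => ?_
  obtain ⟨x, hx, hl⟩ := x
  rcases hi with rfl | rfl
  · simp only [Fin.succAbove_zero] at h
    have := hG.pos_dist_of_ne ((isSeq_succ x).1 hx).1
    rw [len_succ] at hl
    omega
  · simp only [Fin.succAbove_last] at h
    have := hG.pos_dist_of_ne (hx (Fin.last k))
    rw [len_castSucc] at hl
    rw [show (Fin.last k).succ = Fin.last (k + 1) from rfl] at this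
    omega

theorem boundary_eq_sum {G : SimpleGraph V} (hG : G.Connected) (k ℓ : ℕ) :
    boundary G k ℓ = ∑ i : Fin (k + 2), (-1 : ℤ) ^ (i : ℕ) • face G k ℓ i := by
  refine Finset.sum_subset (Finset.filter_subset _ _) fun i _ hi => ?_
  rw [face_end hG, smul_zero]
  simp only [Finset.mem_filter, Finset.mem_univ, true_and] at hi
  tauto

open Classical in
theorem face_face {G : SimpleGraph V} (hG : G.Connected) (k ℓ : ℕ) (i : Fin (k + 3))
    (j : Fin (k + 2)) (x : Seq G (k + 2) ℓ) :
    face G k ℓ j (face G (k + 1) ℓ i (Finsupp.single x 1)) =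
      if h : IsSeq (fun t => x.1 (i.succAbove (j.succAbove t))) ∧
          len G (fun t => x.1 (i.succAbove (j.succAbove t))) = ℓ then
        Finsupp.single ⟨fun t => x.1 (i.succAbove (j.succAbove t)), h⟩ 1
      else 0 := by
  have h1 := len_omit_le_and hG x.1 i
  have h2 := len_omit_le_and hG (fun t => x.1 (i.succAbove t)) j
  have hx := x.2
  simp only [face, Finsupp.linearCombination_single, one_smul]
  rw [faceBasis]
  split_ifs with ha hb hb
  · simp only [Finsupp.linearCombination_single, one_smul]
    rw [faceBasis, dif_pos hb]
  · simp only [Finsupp.linearCombination_single, one_smul]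
    rw [faceBasis, dif_neg hb]
  · have hl : len G (fun t => x.1 (i.succAbove t)) = ℓ := by
      refine le_antisymm (h1.1.trans hx.2.le) ?_
      exact hb.2.symm.le.trans h2.1
    exact absurd ⟨h1.2 hx.1 (hl.trans hx.2.symm), hl⟩ ha
  · simp

/-- The magnitude chain complex of a connected graph is a chain complex. -/
theorem boundary_comp_boundary {G : SimpleGraph V} (hG : G.Connected) (k ℓ : ℕ) :
    boundary G k ℓ ∘ₗ boundary G (k + 1) ℓ = 0 := by
  classical
  refine Finsupp.lhom_ext' fun x => LinearMap.ext_ring ?_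
  simp only [LinearMap.comp_apply, Finsupp.lsingle_apply, LinearMap.zero_apply,
    boundary_eq_sum hG, LinearMap.sum_apply, LinearMap.smul_apply, map_sum, map_smul,
    Finset.smul_sum, smul_smul]
  rw [← Finset.sum_product']
  refine Finset.sum_involution (fun p _ => (p.1.succAbove p.2, p.2.predAbove p.1)) ?_ ?_
    (fun _ _ => Finset.mem_univ _) ?_
  · rintro ⟨i, j⟩ -
    simp only [face_face hG, Fin.succAbove_succAbove_succAbove_predAbove]
    rw [← pow_add, ← pow_add, Fin.neg_one_pow_succAbove_add_predAbove, neg_smul,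
      add_neg_cancel]
  · rintro ⟨i, j⟩ - - h
    exact Fin.succAbove_ne i j (congrArg Prod.fst h)
  · rintro ⟨i, j⟩ -
    simp only [Prod.mk.injEq]
    exact ⟨Fin.succAbove_succAbove_predAbove i j, Fin.predAbove_predAbove_succAbove i j⟩

end General

/-- The graph `G₁` with vertices labelled `1, …, 6`. The vertex type is `Fin 6`, in which the
numerals `1, …, 6` are the six different elements (`6` is another name of `0`). -/
def graphOne : SimpleGraph (Fin 6) :=
  SimpleGraph.fromEdgeSet
    {s(1, 2), s(2, 3), s(3, 4), s(4, 5), s(5, 1), s(2, 5), s(2, 6), s(3, 6), s(4, 6), s(5, 6)}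

end MagnitudeHomology

/-! Diagonality is a discrete Morse argument that encodes a quadratic Gröbner basis. For each pair
at distance 2 a middle vertex is chosen. Read from the left, every sequence is critical (all steps
are edges and no chosen path occurs), or its critical prefix ends at a step of length 2 (a jump), or
it ends at an edge completing a chosen path (a fold). Omitting the chosen vertex matches folds of
degree k+1 with jumps of degree k. In the boundary of a fold, its own jump has coefficient ±1. Each
other term is a fold, or a jump whose fold has strictly smaller weight. By this triangularity
(`single_mem_reducible_of_omits`) the boundary, followed by projection to jumps, maps folds onto
jumps. Since the ranks are finite and matched, it is also injective, so a cycle supported on folds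
is 0. Critical sequences have length equal to their degree, so off the diagonal every chain is a
combination of folds and boundaries of folds, and every cycle bounds. On the diagonal there are no
boundaries and no jumps, and a cycle is determined by its critical part, which is arbitrary. Hence
the rank is the number of critical words. For the given graph these words satisfy a linear
recurrence whose characteristic polynomial is, after q ↦ -q, the denominator of the magnitude. The
magnitude itself comes from an explicit weighting, and the two are compared as power series. The
admissible set is verified separately and plays no role in the proof of diagonality. -/

namespace MagnitudeHomology

/-! ### Tuples as sequences indexed by natural numbers -/

section Words

variable {V : Type*}

/-- The `n`-th entry of a tuple, or the last one if `n` is too large. -/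
def entry {k : ℕ} (x : Fin (k + 1) → V) (n : ℕ) : V := x ⟨min n k, by omega⟩

theorem entry_of_le {k : ℕ} (x : Fin (k + 1) → V) {n : ℕ} (h : n ≤ k) :
    entry x n = x ⟨n, by omega⟩ := by
  simp [entry, h]

theorem ext_entry {k : ℕ} {x y : Fin (k + 1) → V} (h : ∀ n ≤ k, entry x n = entry y n) :
    x = y := by
  funext i
  have := h i (by omega)
  rwa [entry_of_le x (by omega), entry_of_le y (by omega)] at this

/-- The sequence `v` arises from `u` by omitting the entry with number `j`, as far as the entries
up to number `k` are concerned. -/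
def Omits (k j : ℕ) (u v : ℕ → V) : Prop :=
  ∀ n ≤ k, v n = if n < j then u n else u (n + 1)

theorem Omits.of_lt {k j : ℕ} {u v : ℕ → V} (h : Omits k j u v) {n : ℕ} (hn : n ≤ k)
    (hj : n < j) : v n = u n := by
  rw [h n hn, if_pos hj]

theorem Omits.of_le {k j : ℕ} {u v : ℕ → V} (h : Omits k j u v) {n : ℕ} (hn : n ≤ k)
    (hj : j ≤ n) : v n = u (n + 1) := by
  rw [h n hn, if_neg (by omega)]

theorem omits_succAbove {k : ℕ} (x : Fin (k + 2) → V) (j : Fin (k + 2)) :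
    Omits k j (entry x) (entry fun t => x (j.succAbove t)) := by
  intro n hn
  rw [entry_of_le _ hn]
  split_ifs with h
  · rw [entry_of_le _ (by omega), Fin.succAbove_of_castSucc_lt _ _ (by simpa [Fin.lt_def] using h)]
    rfl
  · rw [entry_of_le _ (by omega), Fin.succAbove_of_le_castSucc _ _
      (by simpa [Fin.le_def] using h)]
    rfl

/-- The sum of a function of two consecutive entries over the first `k` steps of a sequence. -/
def pathSum (φ : V → V → ℕ) (k : ℕ) (u : ℕ → V) : ℕ :=
  ∑ n ∈ Finset.range k, φ (u n) (u (n + 1))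

/-- Used twice: with the distance it detects smooth points, and with the weight it compares two
folds over the same jump. Writing it additively avoids subtraction in ℕ. -/
theorem pathSum_omits (φ : V → V → ℕ) {k m : ℕ} {u v : ℕ → V} (hm : m < k)
    (h : Omits k (m + 1) u v) :
    pathSum φ k v + φ (u m) (u (m + 1)) + φ (u (m + 1)) (u (m + 2)) =
      pathSum φ (k + 1) u + φ (u m) (u (m + 2)) := by
  obtain ⟨t, rfl⟩ : ∃ t, k = m + 1 + t := ⟨k - (m + 1), by omega⟩
  have e1 : ∑ n ∈ Finset.range m, φ (v n) (v (n + 1)) =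
      ∑ n ∈ Finset.range m, φ (u n) (u (n + 1)) := by
    refine Finset.sum_congr rfl fun n hn => ?_
    have := Finset.mem_range.1 hn
    rw [h.of_lt (by omega) (by omega), h.of_lt (by omega) (by omega)]
  have e2 : ∑ n ∈ Finset.range t, φ (v (m + 1 + n)) (v (m + 1 + n + 1)) =
      ∑ n ∈ Finset.range t, φ (u (m + 1 + 1 + n)) (u (m + 1 + 1 + n + 1)) := by
    refine Finset.sum_congr rfl fun n hn => ?_
    have := Finset.mem_range.1 hn
    rw [h.of_le (by omega) (by omega), h.of_le (by omega) (by omega),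
      show m + 1 + n + 1 = m + 1 + 1 + n by omega]
  have e3 : v m = u m := h.of_lt (by omega) (by omega)
  have e4 : v (m + 1) = u (m + 2) := h.of_le (by omega) (by omega)
  simp only [pathSum]
  rw [show m + 1 + t + 1 = (m + 1 + 1) + t by omega, Finset.sum_range_add _ (m + 1) t,
    Finset.sum_range_add _ (m + 1 + 1) t]
  simp only [Finset.sum_range_succ _ (m + 1), Finset.sum_range_succ _ m, e1, e2, e3, e4]
  ring

theorem len_eq_pathSum (G : SimpleGraph V) {k : ℕ} (x : Fin (k + 1) → V) :
    len G x = pathSum G.dist k (entry x) := by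
  rw [len, pathSum, Finset.sum_range]
  refine Finset.sum_congr rfl fun i _ => ?_
  rw [entry_of_le x (by omega), entry_of_le x (by omega)]
  rfl

theorem isSeq_iff_entry {k : ℕ} (x : Fin (k + 1) → V) :
    IsSeq x ↔ ∀ n < k, entry x n ≠ entry x (n + 1) := by
  constructor
  · intro h n hn
    rw [entry_of_le x (by omega), entry_of_le x (by omega)]
    exact h ⟨n, hn⟩
  · intro h i
    have := h i i.2
    rw [entry_of_le x (by omega), entry_of_le x (by omega)] at this
    exact this

end Words

/-! ### Critical sequences, jumps, folds and their matching -/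

section Morse

variable {V : Type*}

/-- A choice of a middle vertex `mid a c` for every pair at distance `2` that amounts to a
quadratic Gröbner basis: the chosen paths `(a, mid a c, c)` do not overlap, and each of them is
strictly lighter, with respect to a weight on the pairs of vertices, than the other paths of
length `2` with the same ends. -/
structure IsQuadraticBasis (G : SimpleGraph V) (mid : V → V → V) (wt : V → V → ℕ) : Prop where
  connected : G.Connected
  dist_le_two : ∀ a b, G.dist a b ≤ 2
  dist_left : ∀ a c, G.dist a c = 2 → G.dist a (mid a c) = 1
  dist_right : ∀ a c, G.dist a c = 2 → G.dist (mid a c) c = 1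
  no_overlap : ∀ a c d, G.dist a c = 2 → G.dist (mid a c) d = 2 → mid (mid a c) d ≠ c
  wt_lt : ∀ a b c, G.dist a b = 1 → G.dist b c = 1 → G.dist a c = 2 → b ≠ mid a c →
    wt a (mid a c) + wt (mid a c) c < wt a b + wt b c

variable (G : SimpleGraph V) (mid : V → V → V)

/-- The entries with numbers `n`, `n + 1`, `n + 2` are one of the chosen paths. -/
def NormalAt (u : ℕ → V) (n : ℕ) : Prop :=
  G.dist (u n) (u (n + 2)) = 2 ∧ u (n + 1) = mid (u n) (u (n + 2))

/-- The first `m` steps are edges, and no two consecutive ones of them are a chosen path. -/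
def IsCritical (m : ℕ) (u : ℕ → V) : Prop :=
  (∀ i < m, G.dist (u i) (u (i + 1)) = 1) ∧ ∀ i, i + 1 < m → ¬ NormalAt G mid u i

/-- After a critical part of `m` steps comes a step of length `2`. -/
def IsJump (k : ℕ) (u : ℕ → V) (m : ℕ) : Prop :=
  m < k ∧ IsCritical G mid m u ∧ G.dist (u m) (u (m + 1)) = 2

/-- After a critical part of `m + 1` steps comes an edge that forms a chosen path with the last
of them. -/
def IsFold (k : ℕ) (u : ℕ → V) (m : ℕ) : Prop :=
  m + 1 < k ∧ IsCritical G mid (m + 1) u ∧ G.dist (u (m + 1)) (u (m + 2)) = 1 ∧ NormalAt G mid u m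

variable {G mid}

theorem IsCritical.mono {m n : ℕ} {u : ℕ → V} (h : IsCritical G mid n u) (hmn : m ≤ n) :
    IsCritical G mid m u :=
  ⟨fun i hi => h.1 i (by omega), fun i hi => h.2 i (by omega)⟩

theorem IsCritical.congr {m : ℕ} {u v : ℕ → V} (h : IsCritical G mid m u)
    (huv : ∀ n ≤ m, v n = u n) : IsCritical G mid m v := by
  refine ⟨fun i hi => ?_, fun i hi => ?_⟩
  · rw [huv i (by omega), huv (i + 1) (by omega)]
    exact h.1 i hi
  · rw [NormalAt, huv i (by omega), huv (i + 1) (by omega), huv (i + 2) (by omega)]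
    exact h.2 i hi

theorem IsCritical.pathSum {k : ℕ} {u : ℕ → V} (h : IsCritical G mid k u) :
    pathSum G.dist k u = k := by
  rw [MagnitudeHomology.pathSum, Finset.sum_congr rfl fun i hi => h.1 i (Finset.mem_range.1 hi)]
  simp

theorem IsJump.unique {k m n : ℕ} {u : ℕ → V} (h : IsJump G mid k u m)
    (h' : IsJump G mid k u n) : m = n := by
  by_contra hne
  rcases Nat.lt_or_gt_of_ne hne with hlt | hlt
  · exact absurd ((h'.2.1.1 m hlt).symm.trans h.2.2) (by decide)
  · exact absurd ((h.2.1.1 n hlt).symm.trans h'.2.2) (by decide)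

theorem IsJump.not_isFold {k m n : ℕ} {u : ℕ → V} (h : IsJump G mid k u m) :
    ¬ IsFold G mid k u n := by
  intro h'
  have h2 := h.2.2
  rcases Nat.lt_trichotomy m (n + 1) with hlt | rfl | hlt
  · exact absurd ((h'.2.1.1 m hlt).symm.trans h2) (by decide)
  · exact absurd (h'.2.2.1.symm.trans h2) (by decide)
  · exact h.2.1.2 n hlt h'.2.2.2

theorem IsFold.not_isCritical {k m : ℕ} {u : ℕ → V} (h : IsFold G mid k u m) :
    ¬ IsCritical G mid k u :=
  fun h' => h'.2 m h.1 h.2.2.2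

/-- The first place where the critical prefix cannot be extended shows either a step of length 2 or
a completed chosen path. -/
theorem isCritical_or_isJump_or_isFold (hG : G.Connected) (h2 : ∀ a b, G.dist a b ≤ 2) {k : ℕ}
    {u : ℕ → V} (hu : ∀ n < k, u n ≠ u (n + 1)) :
    IsCritical G mid k u ∨ (∃ m, IsJump G mid k u m) ∨ ∃ m, IsFold G mid k u m := by
  by_contra! hcon
  obtain ⟨hc, hj, hf⟩ := hcon
  refine hc ?_
  suffices ∀ n ≤ k, IsCritical G mid n u from this k le_rfl
  intro n
  induction n with
  | zero => exact fun _ => ⟨fun i hi => by omega, fun i hi => by omega⟩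
  | succ n ih =>
    intro hn
    have ih := ih (by omega)
    have hd : G.dist (u n) (u (n + 1)) = 1 := by
      have h0 := hG.pos_dist_of_ne (hu n (by omega))
      have h1 := h2 (u n) (u (n + 1))
      have h3 : G.dist (u n) (u (n + 1)) ≠ 2 := fun h => hj n ⟨by omega, ih, h⟩
      omega
    refine ⟨fun i hi => ?_, fun i hi hN => ?_⟩
    · rcases Nat.lt_succ_iff_lt_or_eq.1 hi with h | rfl
      exacts [ih.1 i h, hd]
    · rcases Nat.lt_succ_iff_lt_or_eq.1 hi with h | rfl
      exacts [ih.2 i h hN, hf i ⟨by omega, ih, hd, hN⟩]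

theorem IsFold.isJump_of_omits {k m : ℕ} {u v : ℕ → V} (h : IsFold G mid (k + 1) u m)
    (hv : Omits k (m + 1) u v) : IsJump G mid k v m := by
  have hm := h.1
  refine ⟨by omega, (h.2.1.mono (by omega)).congr fun n hn => hv.of_lt (by omega) (by omega), ?_⟩
  rw [hv.of_lt (by omega) (by omega), hv.of_le (by omega) le_rfl]
  exact h.2.2.2.1

variable {wt : V → V → ℕ}

theorem IsJump.isFold_of_omits (hQ : IsQuadraticBasis G mid wt) {k m : ℕ} {u v : ℕ → V}
    (h : IsJump G mid k v m) (hv : Omits k (m + 1) u v)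
    (hu : u (m + 1) = mid (v m) (v (m + 1))) : IsFold G mid (k + 1) u m := by
  obtain ⟨hm, hc, hd⟩ := h
  have e1 : v m = u m := hv.of_lt (by omega) (by omega)
  have e2 : v (m + 1) = u (m + 2) := hv.of_le (by omega) le_rfl
  have hc' : IsCritical G mid m u := hc.congr fun n hn => (hv.of_lt (by omega) (by omega)).symm
  rw [e1, e2] at hu hd
  refine ⟨by omega, ⟨fun i hi => ?_, fun i hi hN => ?_⟩, ?_, hd, hu⟩
  · rcases Nat.lt_succ_iff_lt_or_eq.1 hi with h | rfl
    · exact hc'.1 i h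
    · rw [hu]
      exact hQ.dist_left _ _ hd
  · rcases Nat.lt_succ_iff_lt_or_eq.1 hi with h | rfl
    · exact hc'.2 i h hN
    -- The inserted vertex could only complete a chosen path with the step before it; that path
    -- would overlap the chosen path being inserted.
    · obtain ⟨h1, h2⟩ := hN
      refine hQ.no_overlap (u i) (u (i + 2)) (u (i + 1 + 2)) h1 ?_ ?_
      · rw [← h2, hd]
      · rw [← h2, ← hu]
  · rw [hu]
    exact hQ.dist_right _ _ hd

/-- Omitting another smooth point of a fold at an early place gives a jump, and the omitted point
was not the chosen one. -/
theorem IsFold.isJump_of_omits_of_ne (hQ : IsQuadraticBasis G mid wt) {k m i : ℕ} {u v : ℕ → V}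
    (h : IsFold G mid (k + 1) u m) (hv : Omits k (i + 1) u v) (hi : i < k)
    (him : i ≠ m) (hle : i ≤ m + 1) (hd : G.dist (u i) (u (i + 2)) = 2) :
    IsJump G mid k v i ∧ u (i + 1) ≠ mid (u i) (u (i + 2)) := by
  refine ⟨⟨hi, (h.2.1.mono hle).congr fun n hn => hv.of_lt (by omega) (by omega), ?_⟩,
    fun hN => ?_⟩
  · rwa [hv.of_lt (by omega) (by omega), hv.of_le (by omega) le_rfl]
  · rcases Nat.lt_or_eq_of_le hle with hlt | rfl
    · exact h.2.1.2 i (by omega) ⟨hd, hN⟩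
    -- Here the omitted vertex is the end of the chosen path of the fold, so a second chosen path
    -- through it would overlap the first.
    · obtain ⟨h1, h2⟩ := h.2.2.2
      refine hQ.no_overlap (u m) (u (m + 2)) (u (m + 1 + 2)) h1 ?_ ?_
      · rw [← h2, hd]
      · rw [← h2, ← hN]

/-- The omitted entry lies beyond the chosen path, so the prefix that makes the sequence a fold is
untouched. -/
theorem IsFold.isFold_of_omits {k m i : ℕ} {u v : ℕ → V} (h : IsFold G mid (k + 1) u m)
    (hv : Omits k (i + 1) u v) (hi : i < k) (hle : m + 1 < i) : IsFold G mid k v m := by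
  have e1 : v m = u m := hv.of_lt (by omega) (by omega)
  have e2 : v (m + 1) = u (m + 1) := hv.of_lt (by omega) (by omega)
  have e3 : v (m + 2) = u (m + 2) := hv.of_lt (by omega) (by omega)
  refine ⟨by omega, h.2.1.congr fun n hn => hv.of_lt (by omega) (by omega), ?_⟩
  rw [NormalAt, e1, e2, e3]
  exact h.2.2

end Morse

/-! ### Homology from the matching -/

section Homology

variable {V : Type*} {G : SimpleGraph V} {mid : V → V → V} {wt : V → V → ℕ}

theorem exists_isFold_of_isJump (hQ : IsQuadraticBasis G mid wt) {k ℓ m : ℕ} (y : Seq G k ℓ)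
    (h : IsJump G mid k (entry y.1) m) :
    ∃ x : Seq G (k + 1) ℓ, IsFold G mid (k + 1) (entry x.1) m ∧
      Omits k (m + 1) (entry x.1) (entry y.1) := by
  have hm := h.1
  let b := mid (entry y.1 m) (entry y.1 (m + 1))
  let j : Fin (k + 2) := ⟨m + 1, by omega⟩
  let x : Fin (k + 2) → V := Fin.insertNth (α := fun _ => V) j b y.1
  have hxy : (fun t => x (j.succAbove t)) = y.1 := by
    funext t
    simp [x]
  have ho : Omits k (m + 1) (entry x) (entry y.1) := by
    have := omits_succAbove x j
    rwa [hxy] at this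
  have hb : entry x (m + 1) = b := by
    rw [entry_of_le x (by omega)]
    exact Fin.insertNth_apply_same (α := fun _ => V) j b y.1
  have hf := h.isFold_of_omits hQ ho hb
  have hs := (isSeq_iff_entry y.1).1 y.2.1
  have hl := pathSum_omits G.dist hm ho
  rw [← len_eq_pathSum, ← len_eq_pathSum, y.2.2, hf.2.1.1 m (by omega), hf.2.2.1,
    hf.2.2.2.1] at hl
  refine ⟨⟨x, (isSeq_iff_entry x).2 fun n hn => ?_, by omega⟩, hf, ho⟩
  have hne : ∀ {a c : V}, G.dist a c = 1 → a ≠ c := by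
    rintro a c hac rfl
    simp at hac
  rcases Nat.lt_trichotomy n (m + 1) with hlt | rfl | hlt
  · exact hne (hf.2.1.1 n hlt)
  · exact hne hf.2.2.1
  · obtain ⟨n, rfl⟩ : ∃ n', n = n' + 1 := ⟨n - 1, by omega⟩
    have := hs n (by omega)
    rwa [ho.of_le (by omega) (by omega), ho.of_le (by omega) (by omega)] at this

theorem exists_isJump_of_isFold (hG : G.Connected) {k ℓ m : ℕ} (x : Seq G (k + 1) ℓ)
    (h : IsFold G mid (k + 1) (entry x.1) m) :
    ∃ y : Seq G k ℓ, IsJump G mid k (entry y.1) m ∧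
      Omits k (m + 1) (entry x.1) (entry y.1) := by
  have hm := h.1
  have ho := omits_succAbove x.1 ⟨m + 1, by omega⟩
  have hl := pathSum_omits G.dist (by omega) ho
  rw [← len_eq_pathSum, ← len_eq_pathSum, x.2.2, h.2.1.1 m (by omega), h.2.2.1,
    h.2.2.2.1] at hl
  exact ⟨⟨_, (len_omit_le_and hG x.1 _).2 x.2.1 (by rw [x.2.2]; omega), by omega⟩,
    h.isJump_of_omits ho, ho⟩

variable (G mid) in
/-- The chains supported on folds. -/
def foldSpan (k ℓ : ℕ) : Submodule ℤ (MC G k ℓ) :=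
  Finsupp.supported ℤ ℤ {x : Seq G k ℓ | ∃ m, IsFold G mid k (entry x.1) m}

variable (G mid) in
/-- The chains that are a combination of folds and boundaries of folds. -/
noncomputable def reducible (k ℓ : ℕ) : Submodule ℤ (MC G k ℓ) :=
  foldSpan G mid k ℓ ⊔ (foldSpan G mid (k + 1) ℓ).map (boundary G k ℓ)

theorem single_mem_foldSpan {k ℓ m : ℕ} (x : Seq G k ℓ) (h : IsFold G mid k (entry x.1) m)
    (n : ℤ) : Finsupp.single x n ∈ foldSpan G mid k ℓ :=
  Finsupp.single_mem_supported ℤ n ⟨m, h⟩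

theorem boundary_single (k ℓ : ℕ) (x : Seq G (k + 1) ℓ) :
    boundary G k ℓ (Finsupp.single x 1) =
      ∑ i : Fin (k + 2) with i ≠ 0 ∧ i ≠ Fin.last (k + 1),
        (-1 : ℤ) ^ (i : ℕ) • faceBasis G k ℓ i x := by
  simp [boundary, face]

theorem faceBasis_eq_single {k ℓ : ℕ} (i : Fin (k + 2)) (x : Seq G (k + 1) ℓ) (y : Seq G k ℓ)
    (h : Omits k i (entry x.1) (entry y.1)) : faceBasis G k ℓ i x = Finsupp.single y 1 := by
  have e : (fun j => x.1 (i.succAbove j)) = y.1 :=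
    ext_entry fun n hn => (omits_succAbove x.1 i n hn).trans (h n hn).symm
  have hy := y.2
  rw [← e] at hy
  rw [faceBasis, dif_pos hy]
  congr 1
  exact Subtype.ext e

/-- Solve the boundary of the fold for its own jump, by strong induction on the weight of the fold.
Omissions past the chosen path give folds; earlier ones give jumps with lighter folds. -/
theorem single_mem_reducible_of_omits (hQ : IsQuadraticBasis G mid wt) {k ℓ : ℕ} (N : ℕ)
    (x : Seq G (k + 1) ℓ) (hN : pathSum wt (k + 1) (entry x.1) = N) (m : ℕ)
    (hx : IsFold G mid (k + 1) (entry x.1) m) (y : Seq G k ℓ)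
    (hy : Omits k (m + 1) (entry x.1) (entry y.1)) :
    Finsupp.single y 1 ∈ reducible G mid k ℓ := by
  induction N using Nat.strong_induction_on generalizing x m y with
  | _ N ih =>
  have hm := hx.1
  let j : Fin (k + 2) := ⟨m + 1, by omega⟩
  have hj : j ∈ Finset.univ.filter fun i : Fin (k + 2) => i ≠ 0 ∧ i ≠ Fin.last (k + 1) := by
    simp only [Finset.mem_filter, Finset.mem_univ, true_and, Fin.ext_iff, j, Fin.val_zero,
      Fin.val_last, ne_eq]
    omega
  have hb := boundary_single k ℓ x
  rw [← Finset.add_sum_erase _ _ hj, faceBasis_eq_single j x y hy] at hb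
  have hbmem : boundary G k ℓ (Finsupp.single x 1) ∈ reducible G mid k ℓ :=
    Submodule.mem_sup_right ⟨_, single_mem_foldSpan x hx 1, rfl⟩
  have hrest : ∑ i ∈ (Finset.univ.filter fun i : Fin (k + 2) =>
      i ≠ 0 ∧ i ≠ Fin.last (k + 1)).erase j, (-1 : ℤ) ^ (i : ℕ) • faceBasis G k ℓ i x ∈
        reducible G mid k ℓ := by
    refine Submodule.sum_mem _ fun i hi => Submodule.smul_mem _ _ ?_
    simp only [Finset.mem_erase, Finset.mem_filter, Finset.mem_univ, true_and, Fin.ext_iff, j,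
      Fin.val_zero, Fin.val_last, ne_eq] at hi
    obtain ⟨i, hik⟩ := i
    obtain ⟨i, rfl⟩ : ∃ i', i = i' + 1 := ⟨i - 1, by simp only at hi; omega⟩
    simp only at hi
    rw [faceBasis]
    split_ifs with hz
    swap
    · exact Submodule.zero_mem _
    let z : Seq G k ℓ := ⟨_, hz⟩
    change Finsupp.single z 1 ∈ _
    have ho : Omits k (i + 1) (entry x.1) (entry z.1) := omits_succAbove x.1 ⟨i + 1, hik⟩
    rcases Nat.lt_or_ge (m + 1) i with hlt | hle
    · exact Submodule.mem_sup_left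
        (single_mem_foldSpan z (hx.isFold_of_omits ho (by omega) hlt) 1)
    have hl := pathSum_omits G.dist (by omega) ho
    rw [← len_eq_pathSum, ← len_eq_pathSum, x.2.2, z.2.2] at hl
    have hs := (isSeq_iff_entry x.1).1 x.2.1
    have h1 := hQ.connected.pos_dist_of_ne (hs i (by omega))
    have h2 : 0 < G.dist (entry x.1 (i + 1)) (entry x.1 (i + 2)) :=
      hQ.connected.pos_dist_of_ne (hs (i + 1) (by omega))
    have h3 := hQ.dist_le_two (entry x.1 i) (entry x.1 (i + 2))
    -- At a smooth point two positive distances add up to a distance of at most 2, so both are 1.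
    have hd : G.dist (entry x.1 i) (entry x.1 (i + 2)) = 2 := by omega
    obtain ⟨hz', hne⟩ := hx.isJump_of_omits_of_ne hQ ho (by omega) (by omega) hle hd
    obtain ⟨x', hx', ho'⟩ := exists_isFold_of_isJump hQ z hz'
    refine ih _ ?_ x' rfl i hx' z ho'
    -- Both folds lie over the same jump, so the weight of the step of length 2 cancels and only the
    -- two paths through the middle are compared.
    have w := pathSum_omits wt (by omega) ho
    have w' := pathSum_omits wt (by omega) ho'
    have a1 : entry x'.1 i = entry x.1 i := by
      rw [← ho.of_lt (by omega) (by omega), ho'.of_lt (by omega) (by omega)]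
    have a2 : entry x'.1 (i + 2) = entry x.1 (i + 2) := by
      rw [← ho.of_le (n := i + 1) (by omega) (by omega), ho'.of_le (by omega) (by omega)]
    rw [hx'.2.2.2.2, a1, a2] at w'
    have := hQ.wt_lt _ _ _ (by omega) (by omega) hd hne
    omega
  have hmem : ((-1 : ℤ) ^ (j : ℕ)) • (Finsupp.single y 1 : MC G k ℓ) ∈ reducible G mid k ℓ := by
    rw [eq_sub_of_add_eq hb.symm]
    exact Submodule.sub_mem _ hbmem hrest
  have := Submodule.smul_mem _ ((-1 : ℤ) ^ (j : ℕ)) hmem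
  rwa [smul_smul, ← mul_pow, neg_one_mul, neg_neg, one_pow, one_smul] at this

theorem single_mem_reducible (hQ : IsQuadraticBasis G mid wt) {k ℓ : ℕ} (y : Seq G k ℓ)
    (hy : ¬ IsCritical G mid k (entry y.1)) : Finsupp.single y 1 ∈ reducible G mid k ℓ := by
  rcases isCritical_or_isJump_or_isFold (mid := mid) hQ.connected hQ.dist_le_two
    ((isSeq_iff_entry y.1).1 y.2.1) with h | ⟨m, h⟩ | ⟨m, h⟩
  · exact absurd h hy
  · obtain ⟨x, hx, ho⟩ := exists_isFold_of_isJump hQ y h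
    exact single_mem_reducible_of_omits hQ _ x rfl m hx y ho
  · exact Submodule.mem_sup_left (single_mem_foldSpan y h 1)

theorem reducible_eq_top (hQ : IsQuadraticBasis G mid wt) {k ℓ : ℕ} (h : k ≠ ℓ) :
    reducible G mid k ℓ = ⊤ := by
  rw [eq_top_iff, ← Finsupp.supported_univ, Finsupp.supported_eq_span_single, Submodule.span_le]
  rintro _ ⟨y, -, rfl⟩
  refine single_mem_reducible hQ y fun hc => h ?_
  rw [← hc.pathSum, ← len_eq_pathSum, y.2.2]

/-- The boundary map, from chains of folds to chains of jumps. -/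
noncomputable def foldToJump (G : SimpleGraph V) (mid : V → V → V) (k ℓ : ℕ) :
    foldSpan G mid (k + 1) ℓ →ₗ[ℤ] ({y : Seq G k ℓ | ∃ m, IsJump G mid k (entry y.1) m} →₀ ℤ) :=
  (Finsupp.lsubtypeDomain _ ∘ₗ boundary G k ℓ) ∘ₗ (foldSpan G mid (k + 1) ℓ).subtype

theorem lsubtypeDomain_eq_zero {k ℓ : ℕ} {b : MC G k ℓ} (hb : b ∈ foldSpan G mid k ℓ) :
    (Finsupp.lsubtypeDomain {y : Seq G k ℓ | ∃ m, IsJump G mid k (entry y.1) m} :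
      MC G k ℓ →ₗ[ℤ] _) b = 0 := by
  ext ⟨y, m, hy⟩
  have h := (Finsupp.mem_supported' ℤ b).1 hb y
  exact h fun ⟨n, hn⟩ => hy.not_isFold hn

theorem foldToJump_surjective (hQ : IsQuadraticBasis G mid wt) (k ℓ : ℕ) :
    Function.Surjective (foldToJump G mid k ℓ) := by
  rw [← LinearMap.range_eq_top, eq_top_iff, ← Finsupp.supported_univ,
    Finsupp.supported_eq_span_single, Submodule.span_le]
  rintro _ ⟨⟨y, m, hy⟩, -, rfl⟩
  obtain ⟨x, hx, ho⟩ := exists_isFold_of_isJump hQ y hy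
  obtain ⟨b, hb, _, ⟨c, hc, rfl⟩, hbc⟩ :=
    Submodule.mem_sup.1 (single_mem_reducible_of_omits hQ _ x rfl m hx y ho)
  refine ⟨⟨c, hc⟩, ?_⟩
  have := congrArg (Finsupp.lsubtypeDomain
    {y : Seq G k ℓ | ∃ m, IsJump G mid k (entry y.1) m} : MC G k ℓ →ₗ[ℤ] _) hbc
  rw [map_add, lsubtypeDomain_eq_zero hb, zero_add] at this
  refine this.trans ?_
  ext z
  exact Finsupp.single_apply_left Subtype.val_injective
    (⟨y, m, hy⟩ : {y : Seq G k ℓ | ∃ m, IsJump G mid k (entry y.1) m}) z 1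

/-- The hypothesis says that the jump part of the boundary vanishes, so injectivity of `foldToJump`
suffices. -/
theorem eq_zero_of_boundary_mem_foldSpan [Finite V] (hQ : IsQuadraticBasis G mid wt) {k ℓ : ℕ}
    {b : MC G (k + 1) ℓ} (hb : b ∈ foldSpan G mid (k + 1) ℓ)
    (h : boundary G k ℓ b ∈ foldSpan G mid k ℓ) : b = 0 := by
  have hdel : ∀ x : {x : Seq G (k + 1) ℓ | ∃ m, IsFold G mid (k + 1) (entry x.1) m},
      ∃ y : {y : Seq G k ℓ | ∃ m, IsJump G mid k (entry y.1) m}, ∃ m,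
        IsFold G mid (k + 1) (entry x.1.1) m ∧ IsJump G mid k (entry y.1.1) m ∧
          Omits k (m + 1) (entry x.1.1) (entry y.1.1) := by
    rintro ⟨x, m, hx⟩
    obtain ⟨y, hy, ho⟩ := exists_isJump_of_isFold hQ.connected x hx
    exact ⟨⟨y, m, hy⟩, m, hx, hy, ho⟩
  choose del pos hfold hjump homit using hdel
  have hinj : Function.Injective del := by
    intro x x' e
    have hj := hjump x'
    rw [← e] at hj
    have hp := (hjump x).unique hj
    have ho := homit x
    have ho' := homit x'
    rw [← e, ← hp] at ho'
    have hf := hfold x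
    have hf' := hfold x'
    rw [← hp] at hf'
    have hlt := hf.1
    -- A jump determines its position; all other entries of the fold are copied from it, and the
    -- inserted one is the chosen middle of its neighbours.
    have key : ∀ n ≤ k + 1, n ≠ pos x + 1 → entry x.1.1 n = entry x'.1.1 n := by
      intro n hn hne
      rcases Nat.lt_or_gt_of_ne hne with hlt | hlt
      · rw [← ho.of_lt (by omega) hlt, ← ho'.of_lt (by omega) hlt]
      · obtain ⟨n, rfl⟩ : ∃ n', n = n' + 1 := ⟨n - 1, by omega⟩
        rw [← ho.of_le (by omega) (by omega), ← ho'.of_le (by omega) (by omega)]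
    refine Subtype.ext (Subtype.ext (ext_entry fun n hn => ?_))
    by_cases hne : n = pos x + 1
    · rw [hne, hf.2.2.2.2, hf'.2.2.2.2, key _ (by omega) (by omega), key _ (by omega) (by omega)]
    · exact key n hn hne
  have hi : Function.Injective ((Finsupp.lmapDomain ℤ ℤ del) ∘ₗ
      (Finsupp.supportedEquivFinsupp (R := ℤ) (M := ℤ)
        {x : Seq G (k + 1) ℓ | ∃ m, IsFold G mid (k + 1) (entry x.1) m}).toLinearMap) :=
    (Finsupp.mapDomain_injective hinj).comp (LinearEquiv.injective _)
  -- A surjection onto a finitely generated module is injective if its source also embeds there;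
  -- finiteness of `V` enters here.
  have hT := OrzechProperty.injective_of_surjective_of_injective _ (foldToJump G mid k ℓ) hi
    (foldToJump_surjective hQ k ℓ)
  have h0 : foldToJump G mid k ℓ ⟨b, hb⟩ = foldToJump G mid k ℓ 0 := by
    rw [map_zero]
    exact lsubtypeDomain_eq_zero h
  exact congrArg Subtype.val (hT h0)

theorem eq_zero_of_mem_cycles [Finite V] (hQ : IsQuadraticBasis G mid wt) {k ℓ : ℕ}
    {b : MC G k ℓ} (hb : b ∈ foldSpan G mid k ℓ) (h : b ∈ cycles G k ℓ) : b = 0 := by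
  cases k with
  | zero =>
    ext x
    refine (Finsupp.mem_supported' ℤ b).1 hb x fun ⟨m, hm⟩ => ?_
    have := hm.1
    omega
  | succ k =>
    refine eq_zero_of_boundary_mem_foldSpan hQ hb ?_
    rw [LinearMap.mem_ker.1 h]
    exact Submodule.zero_mem _

theorem boundary_mem_cycles (hG : G.Connected) {k ℓ : ℕ} (c : MC G (k + 1) ℓ) :
    boundary G k ℓ c ∈ cycles G k ℓ := by
  cases k with
  | zero => trivial
  | succ k => exact LinearMap.congr_fun (boundary_comp_boundary hG k ℓ) c

/-- Off the diagonal every cycle is the boundary of a chain of folds. -/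
theorem exists_boundary_eq [Finite V] (hQ : IsQuadraticBasis G mid wt) {k ℓ : ℕ} (hk : k ≠ ℓ)
    {c : MC G k ℓ} (hc : c ∈ cycles G k ℓ) :
    ∃ b ∈ foldSpan G mid (k + 1) ℓ, boundary G k ℓ b = c := by
  have hmem : c ∈ reducible G mid k ℓ := by
    rw [reducible_eq_top hQ hk]
    trivial
  obtain ⟨b, hb, _, ⟨d, hd, rfl⟩, rfl⟩ := Submodule.mem_sup.1 hmem
  have := eq_zero_of_mem_cycles hQ hb
    ((Submodule.add_mem_iff_left _ (boundary_mem_cycles hQ.connected d)).1 hc)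
  exact ⟨d, hd, by rw [this, zero_add]⟩

theorem isDiagonal_of_isQuadraticBasis [Finite V] (hQ : IsQuadraticBasis G mid wt) :
    IsDiagonal G := by
  intro k ℓ hk
  rw [Submodule.Quotient.subsingleton_iff, eq_top_iff]
  rintro ⟨c, hc⟩ -
  obtain ⟨b, -, hb⟩ := exists_boundary_eq hQ hk hc
  exact ⟨b, hb⟩

theorem le_len (hG : G.Connected) {k : ℕ} {x : Fin (k + 1) → V} (hx : IsSeq x) :
    k ≤ len G x := by
  have := Finset.sum_le_sum fun (i : Fin k) (_ : i ∈ Finset.univ) =>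
    Nat.succ_le_of_lt (hG.pos_dist_of_ne (hx i))
  simpa [len] using this

theorem range_boundary_diag (hG : G.Connected) (ℓ : ℕ) :
    LinearMap.range (boundary G ℓ ℓ) = ⊥ := by
  have : IsEmpty (Seq G (ℓ + 1) ℓ) := ⟨fun x => by
    have h1 := le_len hG x.2.1
    have h2 := x.2.2
    omega⟩
  rw [LinearMap.range_eq_bot]
  exact Subsingleton.elim _ _

variable (G mid) in
/-- The words of `k` edges that contain no chosen path. -/
abbrev CriticalWord (k : ℕ) : Type _ := {x : Fin (k + 1) → V // IsCritical G mid k (entry x)}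

/-- A critical word as a sequence on the diagonal. -/
def CriticalWord.toSeq {k : ℕ} (x : CriticalWord G mid k) : Seq G k k :=
  ⟨x.1, (isSeq_iff_entry x.1).2 fun n hn h => by
    have := x.2.1 n hn
    rw [← h] at this
    simp at this, by rw [len_eq_pathSum, x.2.pathSum]⟩

theorem CriticalWord.toSeq_injective {k : ℕ} :
    Function.Injective (CriticalWord.toSeq : CriticalWord G mid k → Seq G k k) :=
  fun _ _ h => Subtype.ext (congrArg (fun s : Seq G k k => s.1) h)

/-- The critical part of a cycle on the diagonal. -/
noncomputable def criticalPart (G : SimpleGraph V) (mid : V → V → V) (ℓ : ℕ) :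
    cycles G ℓ ℓ →ₗ[ℤ] (CriticalWord G mid ℓ →₀ ℤ) :=
  Finsupp.lcomapDomain CriticalWord.toSeq CriticalWord.toSeq_injective ∘ₗ
    (cycles G ℓ ℓ).subtype

theorem criticalPart_apply {ℓ : ℕ} (c : cycles G ℓ ℓ) (x : CriticalWord G mid ℓ) :
    criticalPart G mid ℓ c x = c.1 x.toSeq := rfl

/-- A jump on the diagonal would come from a fold with more steps than its length. A cycle without
critical part is therefore supported on folds, hence 0. -/
theorem criticalPart_injective [Finite V] (hQ : IsQuadraticBasis G mid wt) (ℓ : ℕ) :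
    Function.Injective (criticalPart G mid ℓ) := by
  rw [← LinearMap.ker_eq_bot, LinearMap.ker_eq_bot']
  rintro ⟨c, hc⟩ h
  refine Subtype.ext (eq_zero_of_mem_cycles hQ (mid := mid) ?_ hc)
  refine (Finsupp.mem_supported' ℤ c).2 fun y hy => ?_
  rcases isCritical_or_isJump_or_isFold (mid := mid) hQ.connected hQ.dist_le_two
    ((isSeq_iff_entry y.1).1 y.2.1) with h' | ⟨m, h'⟩ | h'
  · exact DFunLike.congr_fun h ⟨y.1, h'⟩
  · have h1 := y.2.2
    rw [len_eq_pathSum] at h1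
    obtain ⟨x, hx, -⟩ := exists_isFold_of_isJump hQ y h'
    have := le_len hQ.connected x.2.1
    have := x.2.2
    omega
  · exact absurd h' hy

/-- The boundary of a critical chain is a cycle just off the diagonal, so it also bounds a chain of
folds; subtracting that chain gives a cycle with the same critical part. -/
theorem criticalPart_surjective [Finite V] (hQ : IsQuadraticBasis G mid wt) (ℓ : ℕ) :
    Function.Surjective (criticalPart G mid ℓ) := by
  intro κ
  let κ' : MC G ℓ ℓ := κ.mapDomain CriticalWord.toSeq
  obtain ⟨b, hb, hcyc⟩ : ∃ b ∈ foldSpan G mid ℓ ℓ, κ' - b ∈ cycles G ℓ ℓ := by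
    cases ℓ with
    | zero => exact ⟨0, Submodule.zero_mem _, trivial⟩
    | succ ℓ =>
      obtain ⟨b, hb, e⟩ := exists_boundary_eq hQ (by omega)
        (boundary_mem_cycles hQ.connected κ')
      exact ⟨b, hb, by rw [cycles, LinearMap.mem_ker, map_sub, e, sub_self]⟩
  refine ⟨⟨_, hcyc⟩, ?_⟩
  ext x
  rw [criticalPart_apply, Finsupp.sub_apply,
    Finsupp.mapDomain_apply CriticalWord.toSeq_injective,
    (Finsupp.mem_supported' ℤ b).1 hb _ fun ⟨m, hm⟩ => hm.not_isCritical x.2, sub_zero]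

theorem nonempty_equiv_diag [Finite V] (hQ : IsQuadraticBasis G mid wt) (ℓ : ℕ) :
    Nonempty (MH G ℓ ℓ ≃ₗ[ℤ] (Fin (Nat.card (CriticalWord G mid ℓ)) → ℤ)) := by
  have e0 : (LinearMap.range (boundary G ℓ ℓ)).submoduleOf (cycles G ℓ ℓ) = ⊥ := by
    rw [range_boundary_diag hQ.connected, Submodule.submoduleOf, Submodule.comap_bot,
      Submodule.ker_subtype]
  exact ⟨Submodule.quotEquivOfEqBot _ e0 ≪≫ₗ
    LinearEquiv.ofBijective (criticalPart G mid ℓ)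
      ⟨criticalPart_injective hQ ℓ, criticalPart_surjective hQ ℓ⟩ ≪≫ₗ
    Finsupp.domLCongr (Finite.equivFin _) ≪≫ₗ Finsupp.linearEquivFunOnFinite ℤ ℤ _⟩

end Homology

end MagnitudeHomology

namespace MagnitudeHomology

/-! ### Counting critical words by their first edge -/

section Count

variable {V : Type*} {G : SimpleGraph V} {mid : V → V → V}

theorem isCritical_succ_succ (m : ℕ) (u : ℕ → V) :
    IsCritical G mid (m + 2) u ↔
      G.dist (u 0) (u 1) = 1 ∧ ¬ NormalAt G mid u 0 ∧ IsCritical G mid (m + 1) fun i => u (i + 1) := by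
  constructor
  · intro h
    exact ⟨h.1 0 (by omega), h.2 0 (by omega), fun i hi => h.1 (i + 1) (by omega),
      fun i hi => h.2 (i + 1) (by omega)⟩
  · rintro ⟨h0, h1, h2⟩
    refine ⟨fun i hi => ?_, fun i hi => ?_⟩
    · cases i with
      | zero => exact h0
      | succ i => exact h2.1 i (by omega)
    · cases i with
      | zero => exact h1
      | succ i => exact h2.2 i (by omega)

theorem isCritical_one (u : ℕ → V) : IsCritical G mid 1 u ↔ G.dist (u 0) (u 1) = 1 := by
  refine ⟨fun h => h.1 0 (by omega), fun h => ⟨fun i hi => ?_, fun i hi => by omega⟩⟩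
  obtain rfl : i = 0 := by omega
  exact h

variable [Fintype V]

theorem sum_fin_succ_fun {M : Type*} [AddCommMonoid M] (n : ℕ) (f : (Fin (n + 1) → V) → M) :
    ∑ x, f x = ∑ a, ∑ u : Fin n → V, f (Fin.cons a u) := by
  rw [← (Fin.consEquiv fun _ : Fin (n + 1) => V).sum_comp, Fintype.sum_prod_type]
  rfl

theorem card_criticalWord_zero : Nat.card (CriticalWord G mid 0) = Fintype.card V := by
  rw [Nat.card_congr (Equiv.subtypeUnivEquiv fun x => ⟨fun i hi => by omega, fun i hi => by omega⟩),
    Nat.card_eq_fintype_card]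
  simp

variable [DecidableEq V]

/-- One step of the recursion for the number of critical words with given first edge. -/
def criticalStep (d : V → V → ℕ) (mid : V → V → V) (c : V → V → ℕ) (a b : V) : ℕ :=
  if d a b = 1 then ∑ z, if d a z = 2 ∧ b = mid a z then 0 else c b z else 0

/-- The number of critical words with `n + 1` edges that start with `a, b`. -/
def criticalCount (d : V → V → ℕ) (mid : V → V → V) : ℕ → V → V → ℕ
  | 0 => fun a b => if d a b = 1 then 1 else 0
  | n + 1 => criticalStep d mid (criticalCount d mid n)

open Classical in
-- Split off the third vertex `z`. The recursion need not test whether `b, z` is an edge, since the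
-- count is 0 otherwise.
theorem criticalCount_eq_sum (n : ℕ) (a b : V) :
    criticalCount G.dist mid n a b = ∑ u : Fin n → V,
      if IsCritical G mid (n + 1) (entry (Fin.cons a (Fin.cons b u : Fin (n + 1) → V)))
        then 1 else 0 := by
  induction n generalizing a b with
  | zero =>
    rw [Finset.univ_unique, Finset.sum_singleton, if_congr (isCritical_one _) rfl rfl]
    exact if_congr Iff.rfl rfl rfl
  | succ n ih =>
    rw [sum_fin_succ_fun, criticalCount, criticalStep]
    have key (z : V) (u : Fin n → V) :
        IsCritical G mid (n + 1 + 1) (entry (Fin.cons a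
          (Fin.cons b (Fin.cons z u : Fin (n + 1) → V) : Fin (n + 2) → V))) ↔
        G.dist a b = 1 ∧ ¬ (G.dist a z = 2 ∧ b = mid a z) ∧
          IsCritical G mid (n + 1) (entry (Fin.cons b (Fin.cons z u : Fin (n + 1) → V))) := by
      rw [isCritical_succ_succ]
      have e : (fun i => entry (Fin.cons a
          (Fin.cons b (Fin.cons z u : Fin (n + 1) → V) : Fin (n + 2) → V) : Fin (n + 3) → V)
            (i + 1)) = entry (Fin.cons b (Fin.cons z u : Fin (n + 1) → V)) := by
        funext i
        simp only [entry, Nat.add_min_add_right]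
        rfl
      rw [e]
      rfl
    simp only [key, ih]
    split_ifs with h
    · refine Finset.sum_congr rfl fun z _ => ?_
      split_ifs with h'
      · simp [h']
      · simp [h, h']
    · simp [h]

theorem card_criticalWord_succ (n : ℕ) :
    Nat.card (CriticalWord G mid (n + 1)) = ∑ a, ∑ b, criticalCount G.dist mid n a b := by
  classical
  rw [Nat.card_eq_fintype_card, Fintype.card_subtype, Finset.card_filter, sum_fin_succ_fun]
  refine Finset.sum_congr rfl fun a _ => ?_
  rw [sum_fin_succ_fun]
  simp only [criticalCount_eq_sum]

end Count

/-! ### The graph: distances, Gröbner basis, admissible set, ranks -/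

section GraphOne

/-- The distances in `graphOne`. -/
def distOne : Fin 6 → Fin 6 → ℕ :=
  ![![0, 2, 1, 1, 1, 1], ![2, 0, 1, 2, 2, 1], ![1, 1, 0, 1, 2, 1],
    ![1, 2, 1, 0, 1, 2], ![1, 2, 2, 1, 0, 1], ![1, 1, 1, 2, 1, 0]]

theorem graphOne_adj (a b : Fin 6) : graphOne.Adj a b ↔ distOne a b = 1 := by
  simp only [graphOne, SimpleGraph.fromEdgeSet_adj, Set.mem_insert_iff, Set.mem_singleton_iff,
    Sym2.eq_iff]
  revert a b
  decide

/-- These finite checks, with `graphOne_adj`, identify the table with the distance, after which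
properties of the graph become decidable. -/
theorem distOne_cases (a b : Fin 6) :
    a = b ∧ distOne a b = 0 ∨ a ≠ b ∧ distOne a b = 1 ∨
      a ≠ b ∧ distOne a b = 2 ∧ ∃ c, distOne a c = 1 ∧ distOne c b = 1 := by
  revert a b
  decide

theorem graphOne_dist (a b : Fin 6) : graphOne.dist a b = distOne a b := by
  rcases distOne_cases a b with ⟨rfl, h⟩ | ⟨-, h⟩ | ⟨hne, h, c, hac, hcb⟩
  · rw [h, SimpleGraph.dist_self]
  · rw [h, SimpleGraph.dist_eq_one_iff_adj, graphOne_adj, h]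
  · have w : graphOne.Walk a b :=
      .cons ((graphOne_adj a c).2 hac) (.cons ((graphOne_adj c b).2 hcb) .nil)
    have h1 : graphOne.dist a b ≤ 2 := SimpleGraph.dist_le
      (.cons ((graphOne_adj a c).2 hac) (.cons ((graphOne_adj c b).2 hcb) .nil))
    have h2 := w.reachable.pos_dist_of_ne hne
    have h3 : graphOne.dist a b ≠ 1 := by
      rw [Ne, SimpleGraph.dist_eq_one_iff_adj, graphOne_adj, h]
      decide
    omega

theorem graphOne_dist_eq : graphOne.dist = distOne :=
  funext fun a => funext fun b => graphOne_dist a b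

theorem graphOne_connected : graphOne.Connected := by
  refine ⟨fun a b => ?_⟩
  rcases distOne_cases a b with ⟨rfl, -⟩ | ⟨-, h⟩ | ⟨-, -, c, hac, hcb⟩
  · rfl
  · exact ((graphOne_adj a b).2 h).reachable
  · exact ((graphOne_adj a c).2 hac).reachable.trans ((graphOne_adj c b).2 hcb).reachable

theorem distOne_le_two (a b : Fin 6) : distOne a b ≤ 2 := by
  revert a b
  decide

theorem graphOne_diam : graphOne.diam = 2 := by
  have h : graphOne.ediam ≠ ⊤ := SimpleGraph.connected_iff_ediam_ne_top.1 graphOne_connected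
  refine le_antisymm ?_ ?_
  · obtain ⟨a, b, hab⟩ := graphOne.exists_dist_eq_diam
    rw [← hab, graphOne_dist]
    exact distOne_le_two a b
  · have := SimpleGraph.dist_le_diam h (u := 1) (v := 3)
    rwa [graphOne_dist] at this

theorem not_isPawful_graphOne : ¬ IsPawful graphOne := by
  rintro ⟨-, -, h⟩
  rw [graphOne_dist_eq] at h
  -- The only neighbours of 1 are 2 and 5, but 2 is not adjacent to 4, nor 5 to 3.
  exact absurd (h 3 1 4) (by decide)

/-- The middle vertices of the quadratic Gröbner basis. -/
def midOne : Fin 6 → Fin 6 → Fin 6 :=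
  ![![0, 2, 0, 0, 0, 0], ![2, 0, 0, 2, 5, 0], ![0, 0, 0, 0, 5, 0],
    ![0, 2, 0, 0, 0, 0], ![0, 5, 5, 0, 0, 0], ![0, 0, 0, 0, 0, 0]]

/-- The weights of the quadratic Gröbner basis. -/
def weightOne : Fin 6 → Fin 6 → ℕ :=
  ![![0, 0, 0, 0, 1, 0], ![0, 0, 0, 0, 0, 1], ![0, 0, 0, 1, 0, 0],
    ![0, 0, 1, 0, 1, 0], ![1, 0, 0, 1, 0, 0], ![0, 1, 0, 0, 0, 0]]

/-- The edges 15, 23, 34, 46 have weight 1 and all other pairs 0. The paths between 2 and 4 go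
through 5, unlike those of the admissible set: there (1,2,6) and (2,6,4) overlap. In the tables 0 is
both vertex 6 and the filler at pairs not at distance 2. -/
theorem isQuadraticBasis_graphOne : IsQuadraticBasis graphOne midOne weightOne where
  connected := graphOne_connected
  dist_le_two := by rw [graphOne_dist_eq]; exact distOne_le_two
  dist_left := by rw [graphOne_dist_eq]; decide
  dist_right := by rw [graphOne_dist_eq]; decide
  no_overlap := by rw [graphOne_dist_eq]; decide
  wt_lt := by rw [graphOne_dist_eq]; decide

/-! ### The admissible set -/

/-- The middle vertices that define `f₁`. -/
def admissibleMid : Fin 6 → Fin 6 → Fin 6 :=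
  ![![0, 2, 0, 0, 0, 0], ![2, 0, 0, 2, 5, 0], ![0, 0, 0, 0, 0, 0],
    ![0, 2, 0, 0, 0, 0], ![0, 5, 0, 0, 0, 0], ![0, 0, 0, 0, 0, 0]]

/-- The third vertices that define `f₂`. -/
def admissibleThird (α β δ : Fin 6) : Fin 6 :=
  if (α, β, δ) = (1, 2, 4) then 5
  else if (α, β, δ) = (1, 5, 3) then 2
  else if (β, δ) = (0, 1) ∧ (α = 4 ∨ α = 5) then 5
  else admissibleMid β δ

/-- The map `f₁`. -/
def admissibleOne (p : setX' graphOne) : setX graphOne :=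
  ⟨(p.1.1, admissibleMid p.1.1 p.1.2, p.1.2), by
    obtain ⟨⟨a, c⟩, h⟩ := p
    simp only [setX', setX, Set.mem_ofPred_eq, graphOne_dist] at h ⊢
    revert a c
    decide⟩

/-- The map `f₂`. -/
def admissibleTwo (p : setY' graphOne) : setY graphOne :=
  ⟨(p.1.1, p.1.2.1, admissibleThird p.1.1 p.1.2.1 p.1.2.2, p.1.2.2), by
    obtain ⟨⟨a, b, c⟩, h⟩ := p
    simp only [setY', setY, Set.mem_ofPred_eq, graphOne_dist] at h ⊢
    revert a b c
    decide⟩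

theorem mem_range_admissibleOne (a b c : Fin 6) :
    (a, b, c) ∈ Subtype.val '' Set.range admissibleOne ↔
      distOne a c = 2 ∧ b = admissibleMid a c := by
  constructor
  · rintro ⟨_, ⟨⟨⟨a', c'⟩, h⟩, rfl⟩, he⟩
    simp only [admissibleOne, Prod.mk.injEq] at he
    obtain ⟨rfl, rfl, rfl⟩ := he
    exact ⟨(graphOne_dist _ _).symm.trans h, rfl⟩
  · rintro ⟨h, rfl⟩
    exact ⟨_, ⟨⟨(a, c), (graphOne_dist _ _).trans h⟩, rfl⟩, rfl⟩

theorem mem_range_admissibleTwo (α β γ δ : Fin 6) :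
    (α, β, γ, δ) ∈ Subtype.val '' Set.range admissibleTwo ↔
      (distOne α β = 1 ∧ distOne β δ = 2) ∧ γ = admissibleThird α β δ := by
  constructor
  · rintro ⟨_, ⟨⟨⟨α', β', δ'⟩, h⟩, rfl⟩, he⟩
    simp only [admissibleTwo, Prod.mk.injEq] at he
    obtain ⟨rfl, rfl, rfl, rfl⟩ := he
    simp only [setY', Set.mem_ofPred_eq, graphOne_dist] at h
    exact ⟨h, rfl⟩
  · rintro ⟨h, rfl⟩
    refine ⟨_, ⟨⟨(α, β, δ), ?_⟩, rfl⟩, rfl⟩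
    simpa only [setY', Set.mem_ofPred_eq, graphOne_dist] using h

/-- The exceptions in `admissibleThird` repair the default: (1,2,6,4) and (4,6,2,1) would begin with
triples of f₁(X'), and (1,5,6,3) would violate uniqueness, as 5 and 3 have several common
neighbours. -/
theorem isAdmissiblePair_graphOne : IsAdmissiblePair graphOne admissibleOne admissibleTwo where
  proj₁ := rfl
  proj₂ := rfl
  not_mem₂ := by
    intro α β γ δ h ε h'
    rw [mem_range_admissibleTwo] at h h'
    obtain ⟨h, rfl⟩ := h
    revert α β δ ε
    decide
  not_mem₁ := by
    intro α β γ δ h h'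
    rw [mem_range_admissibleTwo] at h
    rw [mem_range_admissibleOne] at h'
    obtain ⟨h, rfl⟩ := h
    revert α β δ
    decide
  unique := by
    intro α β γ δ h
    rw [mem_range_admissibleTwo] at h
    rw [graphOne_dist_eq]
    obtain ⟨h, rfl⟩ := h
    revert α β δ
    decide

theorem image_range_admissibleOne : Subtype.val '' Set.range admissibleOne =
    ({(1, 2, 3), (1, 5, 4), (1, 2, 6), (2, 6, 4), (3, 2, 1), (3, 6, 5),
      (4, 5, 1), (4, 6, 2), (5, 6, 3), (6, 2, 1)} : Set (Fin 6 × Fin 6 × Fin 6)) := by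
  ext ⟨a, b, c⟩
  rw [mem_range_admissibleOne]
  simp only [Set.mem_insert_iff, Set.mem_singleton_iff, Prod.mk.injEq]
  revert a b c
  decide

set_option synthInstance.maxHeartbeats 400000 in
set_option synthInstance.maxSize 1000 in
theorem image_range_admissibleTwo : Subtype.val '' Set.range admissibleTwo =
    ({(2, 1, 2, 3), (5, 1, 2, 3), (2, 1, 5, 4), (5, 1, 5, 4), (2, 1, 2, 6), (5, 1, 2, 6),
      (1, 2, 5, 4), (3, 2, 6, 4), (5, 2, 6, 4), (6, 2, 6, 4),
      (2, 3, 2, 1), (4, 3, 2, 1), (6, 3, 2, 1), (2, 3, 6, 5), (4, 3, 6, 5), (6, 3, 6, 5),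
      (3, 4, 5, 1), (5, 4, 5, 1), (6, 4, 5, 1), (3, 4, 6, 2), (5, 4, 6, 2), (6, 4, 6, 2),
      (1, 5, 2, 3), (2, 5, 6, 3), (4, 5, 6, 3), (6, 5, 6, 3),
      (2, 6, 2, 1), (3, 6, 2, 1), (4, 6, 5, 1), (5, 6, 5, 1)} :
      Set (Fin 6 × Fin 6 × Fin 6 × Fin 6)) := by
  refine Set.Subset.antisymm ?_ ?_
  · rintro ⟨α, β, γ, δ⟩ h
    rw [mem_range_admissibleTwo] at h
    obtain ⟨h, rfl⟩ := h
    simp only [Set.mem_insert_iff, Set.mem_singleton_iff, Prod.mk.injEq]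
    revert α β δ
    decide
  · simp only [Set.insert_subset_iff, Set.singleton_subset_iff, mem_range_admissibleTwo]
    decide

theorem exists_isAdmissibleSet_graphOne :
    ∃ S : Set (setX graphOne ⊕ setY graphOne), IsAdmissibleSet graphOne S ∧
      Subtype.val '' (Sum.inl ⁻¹' S) = Subtype.val '' Set.range admissibleOne ∧
      Subtype.val '' (Sum.inr ⁻¹' S) = Subtype.val '' Set.range admissibleTwo := by
  refine ⟨Sum.inl '' Set.range admissibleOne ∪ Sum.inr '' Set.range admissibleTwo,
    ⟨graphOne_connected, isQuadraticBasis_graphOne.dist_le_two, _, _, isAdmissiblePair_graphOne,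
      rfl⟩, ?_, ?_⟩
  · rw [Set.preimage_union, Set.preimage_image_eq _ Sum.inl_injective,
      Set.preimage_inl_image_inr, Set.union_empty]
  · rw [Set.preimage_union, Set.preimage_image_eq _ Sum.inr_injective,
      Set.preimage_inr_image_inl, Set.empty_union]

/-! ### The number of critical words -/

/-- The rank of `MH_ℓ^ℓ(G₁)`. -/
noncomputable def rankOne (ℓ : ℕ) : ℕ := Nat.card (CriticalWord graphOne midOne ℓ)

theorem rankOne_zero : rankOne 0 = 6 := card_criticalWord_zero

theorem rankOne_succ (n : ℕ) :
    rankOne (n + 1) = ∑ a, ∑ b, criticalCount distOne midOne n a b := by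
  rw [rankOne, card_criticalWord_succ, graphOne_dist_eq]

theorem criticalCount_one : criticalCount distOne midOne 1 =
    ![![0, 0, 3, 3, 3, 4], ![0, 0, 2, 0, 0, 3], ![4, 2, 0, 3, 0, 3],
      ![3, 0, 3, 0, 3, 0], ![4, 0, 0, 3, 0, 2], ![3, 2, 4, 0, 3, 0]] := by
  decide

theorem criticalCount_two : criticalCount distOne midOne 2 =
    ![![0, 0, 10, 9, 9, 12], ![0, 0, 5, 0, 0, 9], ![13, 5, 0, 9, 0, 9],
      ![9, 0, 10, 0, 9, 0], ![13, 0, 0, 9, 0, 6], ![10, 5, 12, 0, 9, 0]] := by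
  rw [criticalCount, criticalCount_one]
  decide

theorem criticalCount_three : criticalCount distOne midOne 3 =
    ![![0, 0, 31, 28, 28, 36], ![0, 0, 14, 0, 0, 27], ![40, 14, 0, 28, 0, 27],
      ![28, 0, 31, 0, 28, 0], ![40, 0, 0, 28, 0, 19], ![31, 14, 36, 0, 28, 0]] := by
  rw [criticalCount, criticalCount_two]
  decide

theorem criticalCount_four : criticalCount distOne midOne 4 =
    ![![0, 0, 95, 87, 87, 109], ![0, 0, 41, 0, 0, 81], ![123, 41, 0, 87, 0, 81],
      ![87, 0, 95, 0, 87, 0], ![123, 0, 0, 87, 0, 59], ![95, 41, 109, 0, 87, 0]] := by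
  rw [criticalCount, criticalCount_three]
  decide

theorem criticalCount_five : criticalCount distOne midOne 5 =
    ![![0, 0, 291, 269, 269, 332], ![0, 0, 122, 0, 0, 245], ![378, 122, 0, 269, 0, 245],
      ![269, 0, 291, 0, 269, 0], ![378, 0, 0, 269, 0, 182], ![291, 122, 332, 0, 269, 0]] := by
  rw [criticalCount, criticalCount_four]
  decide

/-- `criticalStep` is linear in the count, so the recurrence propagates once it holds for the
initial tables. Its coefficients are those of the denominator of the magnitude with q replaced by
-q, up to sign. -/
theorem criticalCount_recurrence (n : ℕ) (a b : Fin 6) :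
    criticalCount distOne midOne (n + 5) a b + 6 * criticalCount distOne midOne (n + 3) a b +
        criticalCount distOne midOne n a b =
      5 * criticalCount distOne midOne (n + 4) a b + criticalCount distOne midOne (n + 1) a b := by
  induction n generalizing a b with
  | zero =>
    simp only [zero_add, criticalCount_five, criticalCount_four, criticalCount_three,
      criticalCount_one]
    revert a b
    decide
  | succ n ih =>
    have e (m : ℕ) : criticalCount distOne midOne (m + 1) a b =
      criticalStep distOne midOne (criticalCount distOne midOne m) a b := rfl
    rw [show n + 1 + 5 = n + 5 + 1 by ring, show n + 1 + 3 = n + 3 + 1 by ring,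
      show n + 1 + 4 = n + 4 + 1 by ring, e, e, e, e, e (n + 1)]
    simp only [criticalStep]
    split_ifs with h
    · simp only [Finset.mul_sum, ← Finset.sum_add_distrib]
      refine Finset.sum_congr rfl fun z _ => ?_
      split_ifs
      exacts [rfl, ih b z]
    · rfl

theorem rankOne_recurrence (n : ℕ) :
    rankOne (n + 6) + 6 * rankOne (n + 4) + rankOne (n + 1) =
      5 * rankOne (n + 5) + rankOne (n + 2) := by
  simp only [rankOne_succ, Finset.mul_sum, ← Finset.sum_add_distrib, criticalCount_recurrence]

theorem rankOne_values : rankOne 1 = 20 ∧ rankOne 2 = 60 ∧ rankOne 3 = 182 ∧ rankOne 4 = 556 ∧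
    rankOne 5 = 1702 ∧ rankOne 6 = 5214 := by
  simp only [rankOne_succ, criticalCount_one, criticalCount_two, criticalCount_three,
    criticalCount_four, criticalCount_five]
  decide

theorem rankOne_seven : rankOne 7 = 15980 := by
  obtain ⟨h1, h2, h3, h4, h5, h6⟩ := rankOne_values
  have := rankOne_recurrence 1
  simp only [Nat.reduceAdd] at this
  omega

end GraphOne
end MagnitudeHomology

namespace MagnitudeHomology

/-! ### The magnitude and its expansion -/

section Magnitude

theorem isUnit_zMatrix_of_connected {V : Type*} [Fintype V] [DecidableEq V] {G : SimpleGraph V}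
    (hG : G.Connected) : IsUnit (zMatrix G) := by
  let P : Matrix V V (Polynomial ℚ) := Matrix.of fun x y => Polynomial.X ^ G.dist x y
  have hZ : zMatrix G = P.map (algebraMap (Polynomial ℚ) (RatFunc ℚ)) := by
    ext x y
    simp [zMatrix, P, RatFunc.algebraMap_X]
  -- At q = 0 only the diagonal survives, because distinct vertices have positive distance.
  have hP : P.map (Polynomial.evalRingHom (0 : ℚ)) = 1 := by
    ext x y
    by_cases h : x = y
    · subst h
      simp [P, Matrix.one_apply_eq]
    · simp [P, Matrix.one_apply_ne h, (hG.pos_dist_of_ne h).ne']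
  have hdet : P.det ≠ 0 := by
    intro h
    have h1 := congrArg (Polynomial.evalRingHom (0 : ℚ)) h
    rw [RingHom.map_det, RingHom.mapMatrix_apply, hP, Matrix.det_one, map_zero] at h1
    exact one_ne_zero h1
  rw [Matrix.isUnit_iff_isUnit_det, isUnit_iff_ne_zero, hZ, ← RingHom.mapMatrix_apply,
    ← RingHom.map_det]
  exact (map_ne_zero_iff _ (RatFunc.algebraMap_injective ℚ)).2 hdet

/-- The magnitude is the sum of any weighting. -/
theorem magnitude_eq_sum {V : Type*} [Fintype V] [DecidableEq V] {G : SimpleGraph V}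
    (hZ : IsUnit (zMatrix G)) (w : V → RatFunc ℚ)
    (hw : ∀ x, ∑ y, RatFunc.X ^ G.dist x y * w y = 1) : magnitude G = ∑ x, w x := by
  have h1 : (zMatrix G).mulVec w = fun _ => 1 := funext hw
  have h2 : (zMatrix G)⁻¹.mulVec (fun _ => 1) = w := by
    rw [← h1, Matrix.mulVec_mulVec, Matrix.nonsing_inv_mul _
      ((Matrix.isUnit_iff_isUnit_det _).1 hZ), Matrix.one_mulVec]
  rw [← h2]
  simp [magnitude, Matrix.mulVec, dotProduct]

theorem denominator_ne_zero : (RatFunc.X ^ 5 + RatFunc.X ^ 4 - 6 * RatFunc.X ^ 2 -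
    5 * RatFunc.X - 1 : RatFunc ℚ) ≠ 0 := by
  have h : (Polynomial.X ^ 5 + Polynomial.X ^ 4 - 6 * Polynomial.X ^ 2 -
      5 * Polynomial.X - 1 : Polynomial ℚ) ≠ 0 := by
    intro h
    have := congrArg (Polynomial.eval 0) h
    simp at this
  have := (map_ne_zero_iff _ (RatFunc.algebraMap_injective ℚ)).2 h
  simpa only [map_sub, map_add, map_mul, map_pow, map_ofNat, map_one,
    RatFunc.algebraMap_X] using this

theorem magnitude_graphOne : magnitude graphOne =
    (2 * RatFunc.X ^ 3 + 4 * RatFunc.X ^ 2 - 10 * RatFunc.X - 6) /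
      (RatFunc.X ^ 5 + RatFunc.X ^ 4 - 6 * RatFunc.X ^ 2 - 5 * RatFunc.X - 1) := by
  have hD := denominator_ne_zero
  set q : RatFunc ℚ := RatFunc.X
  set D : RatFunc ℚ := q ^ 5 + q ^ 4 - 6 * q ^ 2 - 5 * q - 1 with hDdef
  rw [magnitude_eq_sum (isUnit_zMatrix_of_connected graphOne_connected)
    -- A solution of the weighting equations, listed for the vertices 6, 1, 2, 3, 4, 5; it is
    -- invariant under the symmetry exchanging 2 with 5 and 3 with 4.
    (fun x => (![-1 - q + q ^ 2 - q ^ 3, -1 - 3 * q - q ^ 2 + q ^ 3, -1 - q + 2 * q ^ 2,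
      -1 - 2 * q + q ^ 3, -1 - 2 * q + q ^ 3, -1 - q + 2 * q ^ 2] : Fin 6 → RatFunc ℚ) x / D)]
  · rw [← Finset.sum_div]
    congr 1
    simp only [Fin.sum_univ_succ, Fin.sum_univ_zero, Matrix.cons_val_zero, Matrix.cons_val_succ]
    ring
  · intro x
    simp only [← mul_div_assoc]
    rw [← Finset.sum_div, div_eq_one_iff_eq hD, hDdef, graphOne_dist_eq]
    fin_cases x <;>
    simp [Fin.sum_univ_succ, distOne] <;>
    ring

open PowerSeries in
theorem denominator_mul_mk_rankOne :
    (X ^ 5 + X ^ 4 - 6 * X ^ 2 - 5 * X - 1) * mk (fun ℓ => (-1 : ℚ) ^ ℓ * (rankOne ℓ : ℚ)) =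
      (2 * X ^ 3 + 4 * X ^ 2 - 10 * X - 6 : PowerSeries ℚ) := by
  obtain ⟨h1, h2, h3, h4, h5, -⟩ := rankOne_values
  have h0 := rankOne_zero
  have e2 : (2 : PowerSeries ℚ) = C 2 := (map_ofNat C 2).symm
  have e4 : (4 : PowerSeries ℚ) = C 4 := (map_ofNat C 4).symm
  have e5 : (5 : PowerSeries ℚ) = C 5 := (map_ofNat C 5).symm
  have e6 : (6 : PowerSeries ℚ) = C 6 := (map_ofNat C 6).symm
  have e10 : (10 : PowerSeries ℚ) = C 10 := (map_ofNat C 10).symm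
  rw [e2, e4, e5, e6, e10]
  ext n
  simp only [sub_mul, add_mul, mul_assoc, one_mul, map_sub, map_add, coeff_C_mul, coeff_mk,
    coeff_X_pow_mul', coeff_X_pow]
  -- The rank recurrence starts only at r₁, since r₀ counts words without edges; coefficients 0 to 5
  -- are therefore checked by hand.
  rcases n with _ | _ | _ | _ | _ | _ | n
  · simp [h0]
  · simp [h0, h1, coeff_one_X]
    norm_num
  · simp [h0, h1, h2, coeff_succ_X_mul, coeff_X]
    norm_num
  · simp [h1, h2, h3, coeff_succ_X_mul, coeff_X]
    norm_num
  · simp [h0, h2, h3, h4, coeff_succ_X_mul, coeff_X]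
    norm_num
  · simp [h0, h1, h3, h4, h5, coeff_succ_X_mul, coeff_X]
    norm_num
  · have h : (rankOne (n + 6) + 6 * rankOne (n + 4) + rankOne (n + 1) : ℚ) =
      5 * rankOne (n + 5) + rankOne (n + 2) := by exact_mod_cast rankOne_recurrence n
    simp [coeff_succ_X_mul, coeff_X]
    linear_combination (-(-1) ^ n) * h

theorem coe_magnitude_graphOne :
    ((magnitude graphOne : RatFunc ℚ) : LaurentSeries ℚ) =
      HahnSeries.ofPowerSeries ℤ ℚ
        (PowerSeries.mk fun ℓ => (-1 : ℚ) ^ ℓ * (rankOne ℓ : ℚ)) := by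
  have hX : HahnSeries.ofPowerSeries ℤ ℚ PowerSeries.X =
      ((RatFunc.X : RatFunc ℚ) : LaurentSeries ℚ) := by
    rw [RatFunc.coe_X, HahnSeries.ofPowerSeries_X]
  have h := congrArg (HahnSeries.ofPowerSeries ℤ ℚ) denominator_mul_mk_rankOne
  simp only [map_mul, map_sub, map_add, map_pow, map_ofNat, map_one, hX] at h
  rw [magnitude_graphOne, map_div₀, div_eq_iff ((map_ne_zero _).2 denominator_ne_zero)]
  simp only [map_mul, map_sub, map_add, map_pow, map_ofNat, map_one]
  rw [← h, mul_comm]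

end Magnitude
end MagnitudeHomology

open MagnitudeHomology in
theorem mainTheorem5 :
    graphOne.Connected ∧ graphOne.diam = 2 ∧ ¬ IsPawful graphOne ∧
    (∃ S : Set (setX graphOne ⊕ setY graphOne), IsAdmissibleSet graphOne S ∧
      Subtype.val '' (Sum.inl ⁻¹' S) =
        ({(1, 2, 3), (1, 5, 4), (1, 2, 6), (2, 6, 4), (3, 2, 1), (3, 6, 5),
          (4, 5, 1), (4, 6, 2), (5, 6, 3), (6, 2, 1)} : Set (Fin 6 × Fin 6 × Fin 6)) ∧
      Subtype.val '' (Sum.inr ⁻¹' S) =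
        ({(2, 1, 2, 3), (5, 1, 2, 3), (2, 1, 5, 4), (5, 1, 5, 4), (2, 1, 2, 6), (5, 1, 2, 6),
          (1, 2, 5, 4), (3, 2, 6, 4), (5, 2, 6, 4), (6, 2, 6, 4),
          (2, 3, 2, 1), (4, 3, 2, 1), (6, 3, 2, 1), (2, 3, 6, 5), (4, 3, 6, 5), (6, 3, 6, 5),
          (3, 4, 5, 1), (5, 4, 5, 1), (6, 4, 5, 1), (3, 4, 6, 2), (5, 4, 6, 2), (6, 4, 6, 2),
          (1, 5, 2, 3), (2, 5, 6, 3), (4, 5, 6, 3), (6, 5, 6, 3),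
          (2, 6, 2, 1), (3, 6, 2, 1), (4, 6, 5, 1), (5, 6, 5, 1)} :
          Set (Fin 6 × Fin 6 × Fin 6 × Fin 6))) ∧
    IsDiagonal graphOne ∧
    IsUnit (zMatrix graphOne) ∧
    magnitude graphOne =
      (2 * RatFunc.X ^ 3 + 4 * RatFunc.X ^ 2 - 10 * RatFunc.X - 6) /
        (RatFunc.X ^ 5 + RatFunc.X ^ 4 - 6 * RatFunc.X ^ 2 - 5 * RatFunc.X - 1) ∧
    ∃ r : ℕ → ℕ,
      ((magnitude graphOne : RatFunc ℚ) : LaurentSeries ℚ) =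
        HahnSeries.ofPowerSeries ℤ ℚ (PowerSeries.mk fun ℓ => (-1 : ℚ) ^ ℓ * (r ℓ : ℚ)) ∧
      (r 0 = 6 ∧ r 1 = 20 ∧ r 2 = 60 ∧ r 3 = 182 ∧ r 4 = 556 ∧ r 5 = 1702 ∧ r 6 = 5214 ∧
        r 7 = 15980) ∧
      ∀ ℓ : ℕ, Nonempty (MH graphOne ℓ ℓ ≃ₗ[ℤ] (Fin (r ℓ) → ℤ)) := by
  obtain ⟨h1, h2, h3, h4, h5, h6⟩ := rankOne_values
  obtain ⟨S, hS, hS₁, hS₂⟩ := exists_isAdmissibleSet_graphOne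
  exact ⟨graphOne_connected, graphOne_diam, not_isPawful_graphOne,
    ⟨S, hS, hS₁.trans image_range_admissibleOne, hS₂.trans image_range_admissibleTwo⟩,
    isDiagonal_of_isQuadraticBasis isQuadraticBasis_graphOne,
    isUnit_zMatrix_of_connected graphOne_connected, magnitude_graphOne, rankOne,
    coe_magnitude_graphOne, ⟨rankOne_zero, h1, h2, h3, h4, h5, h6, rankOne_seven⟩,
    nonempty_equiv_diag isQuadraticBasis_graphOne⟩
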